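/- Let $\mathcal V$ and $\mathcal W$ be varieties of algebras (possibly of different finitary functional signatures, nullary symbols allowed), each of which is the class of all nonempty models of some set of identities of height at most $1$, that is, of identities $s\approx t$ in which each of $s,t$ is a variable or a term $f(x_1,\dots,x_k)$ with $f$ a basic operation symbol of arity $k\ge 0$ and $x_1,\dots,x_k$ not necessarily distinct variables. Write $\mathcal X\le\mathcal Y$ if there is a clone homomorphism from the clone of $\mathcal X$ to the clone of $\mathcal Y$, i.e. a map from the term operations of $\mathcal X$ of positive arity to those of $\mathcal Y$ that preserves arities, projections and composition. Let $\mathcal V\vee\mathcal W$ denote the join of $\mathcal V$ and $\mathcal W$ in the lattice of interpretability types of varieties, that is, any variety that is a least upper bound of $\mathcal V$ and $\mathcal W$ for the quasi-order $\le$; for instance, the variety whose signature is the disjoint union of the signatures of $\mathcal V$ and $\mathcal W$ and whose defining identities are the union of their defining identities. 1. If neither $\mathcal V$ nor $\mathcal W$ is congruence modular, then $\mathcal V\vee\mathcal W$ is not congruence modular. (A variety is congruence modular if the congruence lattice of each of its members is modular.) 2. If, for every $n\ge 2$, neither $\mathcal V$ nor $\mathcal W$ is congruence $n$-permutable, then for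 every $n\ge 2$ the variety $\mathcal V\vee\mathcal W$ is not congruence $n$-permutable. (A variety is congruence $n$-permutable if $\theta\circ\psi\circ\theta\circ\cdots=\psi\circ\theta\circ\psi\circ\cdots$, with $n$ factors on each side, for all congruences $\theta,\psi$ of each of its members.) -/

import Mathlib

open FirstOrder FirstOrder.Language

universe u

/-- The height of a term: variables have height `0`, and `f(t₁, …, tₙ)` has height one more than the
largest height of the `tᵢ`. In particular a nullary symbol, like every `f(x₁, …, xₙ)` with variables
`xᵢ`, has height `1`. -/
def termHeight {L : FirstOrder.Language.{u, 0}} {α : Type} : L.Term α → ℕ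
  | .var _ => 0
  | .func _ ts => (Finset.univ.sup fun i => termHeight (ts i)) + 1

/-- The identity `s ≈ t` holds in the algebra `A`. -/
def SatisfiesIdentity (L : FirstOrder.Language.{u, 0}) (A : Type u) [L.Structure A] {α : Type}
    (s t : L.Term α) : Prop :=
  ∀ v : α → A, s.realize v = t.realize v

/-- A variety of algebras, presented by a purely functional signature and a set of identities in
countably many variables. The class of algebras itself is `Variety.Mem`. -/
structure Variety where
  /-- the signature -/
  L : FirstOrder.Language.{u, 0}
  /-- the signature has no relation symbols -/
  algebraic : L.IsAlgebraic
  /-- a set of identities that defines the variety -/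
  identities : Set (L.Term ℕ × L.Term ℕ)

namespace Variety

/-- The algebra `A` (with nonempty domain) is a model of the set `E` of identities. -/
def IsModel {L : FirstOrder.Language.{u, 0}} (E : Set (L.Term ℕ × L.Term ℕ)) (A : Type u) [L.Structure A] :
    Prop :=
  Nonempty A ∧ ∀ e ∈ E, SatisfiesIdentity L A e.1 e.2

/-- The algebra `A` belongs to the variety `V`. -/
def Mem (V : Variety.{u}) (A : Type u) [V.L.Structure A] : Prop :=
  IsModel V.identities A

/-- `V` is, as a class of algebras, the class of models of some set of identities `s ≈ t` in which
both `s` and `t` have height at most `1`. -/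
def DefinedByHeightAtMostOne (V : Variety.{u}) : Prop :=
  ∃ E : Set (V.L.Term ℕ × V.L.Term ℕ),
    (∀ e ∈ E, termHeight e.1 ≤ 1 ∧ termHeight e.2 ≤ 1) ∧
    ∀ (A : Type u) [V.L.Structure A], V.Mem A ↔ IsModel E A

end Variety

/-! ### Congruences -/

/-- A congruence of the `L`-algebra `A`: an equivalence relation preserved by all basic
operations. -/
@[ext]
structure Congruence (L : FirstOrder.Language.{u, 0}) (A : Type u) [L.Structure A] where
  /-- the underlying equivalence relation -/
  toSetoid : Setoid A
  compatible : ∀ {n : ℕ} (f : L.Functions n) (x y : Fin n → A),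
    (∀ i, toSetoid (x i) (y i)) → toSetoid (Structure.funMap f x) (Structure.funMap f y)

namespace Congruence

variable {L : FirstOrder.Language.{u, 0}} {A : Type u} [L.Structure A]

/-- Congruences are ordered by inclusion. -/
instance : PartialOrder (Congruence L A) :=
  PartialOrder.lift Congruence.toSetoid fun _ _ h => Congruence.ext h

/-- The infimum of a set of congruences is its intersection. -/
instance : InfSet (Congruence L A) where
  sInf S :=
    { toSetoid :=
        { r := fun a b => ∀ θ ∈ S, θ.toSetoid a b
          iseqv :=
            ⟨fun _ θ _ => θ.toSetoid.refl _, fun h θ hθ => θ.toSetoid.symm (h θ hθ),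
             fun h k θ hθ => θ.toSetoid.trans (h θ hθ) (k θ hθ)⟩ }
      compatible := fun f x y h θ hθ => θ.compatible f x y fun i => h i θ hθ }

/-- The congruence lattice of `A`; the supremum is the least congruence above. -/
instance : CompleteLattice (Congruence L A) :=
  completeLatticeOfInf _ fun _ =>
    ⟨fun θ hθ _ _ h => h θ hθ, fun _ hψ _ _ h _ hθ => hψ hθ h⟩

/-- The `n`-fold alternating relational product `θ ∘ ψ ∘ θ ∘ ⋯` with `n` factors. -/
def altComp : ℕ → Congruence L A → Congruence L A → A → A → Prop
  | 0, _, _ => Eq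
  | n + 1, θ, ψ => Relation.Comp (fun a b => θ.toSetoid a b) (altComp n ψ θ)

end Congruence

namespace Variety

/-- A variety is congruence modular if all its members have modular congruence lattices. -/
def CongruenceModular (V : Variety.{u}) : Prop :=
  ∀ (A : Type u) [V.L.Structure A], V.Mem A → IsModularLattice (Congruence V.L A)

/-- A variety is congruence `n`-permutable if `θ ∘ ψ ∘ θ ∘ ⋯ = ψ ∘ θ ∘ ψ ∘ ⋯` (`n` factors on both
sides) for all congruences `θ`, `ψ` of a member. This notion is meant for `n ≥ 2`. -/
def CongruencePermutable (V : Variety.{u}) (n : ℕ) : Prop :=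
  ∀ (A : Type u) [V.L.Structure A], V.Mem A →
    ∀ θ ψ : Congruence V.L A, Congruence.altComp n θ ψ = Congruence.altComp n ψ θ

/-! ### The clone of a variety and the interpretability quasi-order -/

/-- Two `n`-ary terms are equivalent if they induce the same operation on all members of `V`. -/
def termSetoid (V : Variety.{u}) (n : ℕ) : Setoid (V.L.Term (Fin n)) where
  r s t := ∀ (A : Type u) [V.L.Structure A], V.Mem A → SatisfiesIdentity V.L A s t
  iseqv :=
    ⟨fun _ _ _ _ _ => rfl, fun h A _ hA v => (h A hA v).symm,
     fun h k A _ hA v => (h A hA v).trans (k A hA v)⟩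

/-- The `n`-ary part of the clone of `V`: the `n`-ary term operations of `V`, that is, `n`-ary terms
modulo the identities valid in `V`. For every generator of `V` this is the same thing as the set of
its `n`-ary term operations, since a generator satisfies the same identities as `V`. -/
def Clo (V : Variety.{u}) (n : ℕ) : Type u := Quotient (V.termSetoid n)

namespace Clo

variable {V : Variety.{u}} {n m : ℕ}

/-- The term operation given by a term. -/
def mk (t : V.L.Term (Fin n)) : V.Clo n := Quotient.mk (V.termSetoid n) t

/-- The `i`-th `n`-ary projection. -/
def proj (i : Fin n) : V.Clo n := mk (.var i)

/-- Composition `f(g₁, …, gₙ)`. -/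
noncomputable def comp (f : V.Clo n) (g : Fin n → V.Clo m) : V.Clo m :=
  mk ((Quotient.out f).subst fun i => Quotient.out (g i))

/-- Composition does not depend on the terms that represent the operations. -/
theorem comp_mk (t : V.L.Term (Fin n)) (s : Fin n → V.L.Term (Fin m)) :
    comp (mk t) (fun i => mk (s i)) = mk (t.subst s) := by
  refine Quotient.sound fun A _ hA v => ?_
  rw [Term.realize_subst, Term.realize_subst]
  have h1 : ∀ w, (Quotient.out (mk t)).realize w = t.realize w :=
    Quotient.mk_out (s := V.termSetoid n) t A hA
  have h2 : ∀ i w, (Quotient.out (mk (s i))).realize w = (s i).realize w := fun i =>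
    Quotient.mk_out (s := V.termSetoid m) (s i) A hA
  simp only [h1, h2]

end Clo

/-- A clone homomorphism from the clone of `V` to the clone of `W`. As usual for function clones,
only operations of positive arity are considered (a constant is viewed as a constant unary
operation). -/
structure CloneHom (V W : Variety.{u}) where
  /-- the map on operations of arity `n + 1` -/
  toFun : ∀ n : ℕ, V.Clo (n + 1) → W.Clo (n + 1)
  map_proj : ∀ (n : ℕ) (i : Fin (n + 1)), toFun n (Clo.proj i) = Clo.proj i
  map_comp : ∀ (n m : ℕ) (f : V.Clo (n + 1)) (g : Fin (n + 1) → V.Clo (m + 1)),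
    toFun m (Clo.comp f g) = Clo.comp (toFun n f) fun i => toFun m (g i)

/-- The interpretability quasi-order on varieties. -/
def Interpretable (V W : Variety.{u}) : Prop := Nonempty (CloneHom V W)

/-- `U` represents the join of `V` and `W` in the lattice of interpretability types of varieties:
it is a least upper bound of `V` and `W` in the interpretability quasi-order. -/
def IsJoin (V W U : Variety.{u}) : Prop :=
  Interpretable V U ∧ Interpretable W U ∧
    ∀ X : Variety.{u}, Interpretable V X → Interpretable W X → Interpretable U X

/-- The standard representative of the join: the signature is the disjoint union of the signatures
and the defining identities are the union of the defining identities. -/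
def join (V W : Variety.{u}) : Variety.{u} where
  L := V.L.sum W.L
  algebraic := by
    have := V.algebraic
    have := W.algebraic
    infer_instance
  identities :=
    Prod.map LHom.sumInl.onTerm LHom.sumInl.onTerm '' V.identities ∪
      Prod.map LHom.sumInr.onTerm LHom.sumInr.onTerm '' W.identities

/-! ### The join exists -/

namespace Clo
variable {V : Variety.{u}} {n m : ℕ}

/-- The operation that an element of the clone of `V` induces on a member `A` of `V`. -/
noncomputable def eval (f : V.Clo n) {A : Type u} [V.L.Structure A] (v : Fin n → A) : A :=
  (Quotient.out f).realize v

theorem eval_mk {A : Type u} [V.L.Structure A] (hA : V.Mem A) (t : V.L.Term (Fin n))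
    (v : Fin n → A) : (mk t).eval v = t.realize v :=
  Quotient.mk_out (s := V.termSetoid n) t A hA v

theorem eval_proj {A : Type u} [V.L.Structure A] (hA : V.Mem A) (i : Fin n) (v : Fin n → A) :
    (proj i : V.Clo n).eval v = v i :=
  eval_mk hA _ v

theorem eval_comp {A : Type u} [V.L.Structure A] (hA : V.Mem A) (f : V.Clo n)
    (g : Fin n → V.Clo m) (v : Fin m → A) :
    (comp f g).eval v = f.eval fun i => (g i).eval v := by
  rw [comp, eval_mk hA, Term.realize_subst]; rfl

theorem ext_eval {f g : V.Clo n}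
    (h : ∀ (A : Type u) [V.L.Structure A], V.Mem A → ∀ v : Fin n → A, f.eval v = g.eval v) :
    f = g := by
  rw [← Quotient.out_eq f, ← Quotient.out_eq g]
  exact Quotient.sound fun A _ hA v => h A hA v

end Clo

/-- A term only depends on finitely many variables. -/
theorem realize_relabel_min {L : FirstOrder.Language.{u, 0}} {A : Type u} [L.Structure A]
    (v : ℕ → A) (t : L.Term ℕ) : ∃ N, ∀ m, N ≤ m →
    (t.relabel fun k => (⟨min k m, by omega⟩ : Fin (m + 1))).realize (fun i : Fin (m + 1) => v i) =
      t.realize v := by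
  induction t with
  | var k => exact ⟨k, fun m h => by simp [h]⟩
  | func f ts ih =>
    choose N hN using ih
    refine ⟨Finset.univ.sup N, fun m h => ?_⟩
    simp only [Term.relabel, Term.realize_func]
    congr 1
    funext i
    exact hN i m ((Finset.le_sup (Finset.mem_univ i)).trans h)

/-- The operation symbol `f` with an additional dummy variable. -/
def dummy {L : FirstOrder.Language.{u, 0}} {n : ℕ} (f : L.Functions n) : L.Term (Fin (n + 1)) :=
  .func f fun i => .var i.castSucc

section
variable {V X : Variety.{u}}

theorem realize_dummy {n : ℕ} (f : V.L.Functions n) {A : Type u} [V.L.Structure A]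
    (x : Fin n → A) (a : A) :
    (dummy f).realize (Fin.snoc x a : Fin (n + 1) → A) = Structure.funMap f x := by
  simp [dummy]

theorem eval_snoc_eq (ξ : CloneHom V X) {n : ℕ} (f : V.L.Functions n) {B : Type u}
    [X.L.Structure B] (hB : X.Mem B) (x : Fin n → B) (b c : B) :
    (ξ.toFun n (Clo.mk (dummy f))).eval (Fin.snoc x b : Fin (n + 1) → B) =
    (ξ.toFun n (Clo.mk (dummy f))).eval (Fin.snoc x c : Fin (n + 1) → B) := by
  let p : Fin (n + 1) → V.Clo (n + 2) :=
    Fin.snoc (fun i => Clo.proj i.castSucc.castSucc) (Clo.proj (Fin.last n).castSucc)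
  let q : Fin (n + 1) → V.Clo (n + 2) :=
    Fin.snoc (fun i => Clo.proj i.castSucc.castSucc) (Clo.proj (Fin.last (n + 1)))
  have hpq : Clo.comp (Clo.mk (dummy f)) p = Clo.comp (Clo.mk (dummy f)) q := by
    refine Clo.ext_eval fun A _ hA v => ?_
    rw [Clo.eval_comp hA, Clo.eval_comp hA, Clo.eval_mk hA, Clo.eval_mk hA]
    simp [dummy, p, q]
  have h := congrArg (fun F => (ξ.toFun (n + 1) F).eval
    (Fin.snoc (Fin.snoc x b : Fin (n + 1) → B) c : Fin (n + 2) → B)) hpq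
  simp only [ξ.map_comp, Clo.eval_comp hB] at h
  convert h using 2 <;> funext i <;> refine Fin.lastCases ?_ (fun j => ?_) i <;>
    simp [p, q, ξ.map_proj, Clo.eval_proj hB]

/-- A clone homomorphism from `V` to `X` turns members of `X` into algebras in the signature of
`V`. -/
@[reducible]
noncomputable def pullback (ξ : CloneHom V X) (B : Type u) [X.L.Structure B] (b : B) :
    V.L.Structure B where
  funMap {n} f x := (ξ.toFun n (Clo.mk (dummy f))).eval (Fin.snoc x b : Fin (n + 1) → B)
  RelMap {n} r := ((V.algebraic n).false r).elim

theorem comp_dummy {n m : ℕ} (f : V.L.Functions n) (ts : Fin n → V.L.Term (Fin (m + 1))) :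
    Clo.comp (Clo.mk (dummy f))
      (Fin.snoc (fun i => Clo.mk (ts i)) (Clo.proj 0) : Fin (n + 1) → V.Clo (m + 1)) =
    Clo.mk (.func f ts) := by
  refine Clo.ext_eval fun A _ hA v => ?_
  rw [Clo.eval_comp hA, Clo.eval_mk hA, Clo.eval_mk hA]
  simp [dummy, Clo.eval_mk hA]

theorem realize_pullback (ξ : CloneHom V X) {B : Type u} [X.L.Structure B] (hB : X.Mem B) (b : B)
    {m : ℕ} (t : V.L.Term (Fin (m + 1))) (v : Fin (m + 1) → B) :
    letI := pullback ξ B b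
    t.realize v = (ξ.toFun m (Clo.mk t)).eval v := by
  let := pullback ξ B b
  induction t with
  | var i =>
    change v i = (ξ.toFun m (Clo.proj i)).eval v
    rw [ξ.map_proj, Clo.eval_proj hB]
  | func f ts ih =>
    rw [← comp_dummy, ξ.map_comp, Clo.eval_comp hB, Term.realize_func]
    change (ξ.toFun _ (Clo.mk (dummy f))).eval (Fin.snoc _ b : Fin _ → B) = _
    rw [eval_snoc_eq ξ f hB _ b (v 0)]
    congr 1
    funext i
    refine Fin.lastCases ?_ (fun j => ?_) i
    · simp [ξ.map_proj, Clo.eval_proj hB]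
    · simpa using ih j

theorem mem_pullback (ξ : CloneHom V X) {B : Type u} [X.L.Structure B] (hB : X.Mem B) (b : B) :
    letI := pullback ξ B b
    V.Mem B := by
  let := pullback ξ B b
  refine ⟨⟨b⟩, fun e he v => ?_⟩
  obtain ⟨N, hN⟩ := realize_relabel_min v e.1
  obtain ⟨M, hM⟩ := realize_relabel_min v e.2
  rw [← hN (max N M) (le_max_left _ _), ← hM (max N M) (le_max_right _ _),
    realize_pullback ξ hB b, realize_pullback ξ hB b]
  congr 2
  refine Quotient.sound fun A _ hA w => ?_
  rw [Term.realize_relabel, Term.realize_relabel]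
  exact hA.2 e he _

end

variable {V W X : Variety.{u}}


/-- An inclusion of presentations induces a clone homomorphism. -/
theorem interpretable_of_lhom (φ : V.L →ᴸ X.L)
    (hφ : ∀ e ∈ V.identities, (φ.onTerm e.1, φ.onTerm e.2) ∈ X.identities) :
    Interpretable V X := by
  have key : ∀ (A : Type u) [X.L.Structure A], X.Mem A →
      @Variety.Mem V A (φ.reduct A) := by
    intro A iA hA
    let := φ.reduct A
    refine ⟨hA.1, fun e he v => ?_⟩
    have := hA.2 _ (hφ e he) v
    simpa [LHom.realize_onTerm] using this
  have hmk : ∀ {n : ℕ} (s t : V.L.Term (Fin n)), (V.termSetoid n) s t →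
      (X.termSetoid n) (φ.onTerm s) (φ.onTerm t) := by
    intro n s t h A _ hA v
    let := φ.reduct A
    rw [LHom.realize_onTerm, LHom.realize_onTerm]
    exact h A (key A hA) v
  refine ⟨⟨fun n => Quotient.map φ.onTerm fun s t h => hmk s t h, fun n i => rfl,
    fun n m f g => ?_⟩⟩
  obtain ⟨t, rfl⟩ := Quotient.exists_rep f
  obtain ⟨s, rfl⟩ : ∃ s : Fin (n + 1) → V.L.Term (Fin (m + 1)), g = fun i => Clo.mk (s i) :=
    ⟨fun i => Quotient.out (g i), funext fun i => (Quotient.out_eq (g i)).symm⟩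
  change Quotient.map _ _ (Clo.comp (Clo.mk t) _) = Clo.comp (Clo.mk (φ.onTerm t))
    (fun i => Clo.mk (φ.onTerm (s i)))
  rw [Clo.comp_mk, Clo.comp_mk]
  refine Quotient.sound fun A _ hA v => ?_
  let := φ.reduct A
  simp only [LHom.realize_onTerm, Term.realize_subst]

/-- The map on terms of the join that is determined by clone homomorphisms from `V` and `W`. -/
noncomputable def joinMap (ξ : CloneHom V X) (η : CloneHom W X) {m : ℕ} :
    (V.L.sum W.L).Term (Fin (m + 1)) → X.Clo (m + 1)
  | .var i => Clo.proj i
  | .func (l := n) (.inl f) ts => Clo.comp (ξ.toFun n (Clo.mk (dummy f)))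
      (Fin.snoc (fun i => joinMap ξ η (ts i)) (Clo.proj 0) : Fin (n + 1) → X.Clo (m + 1))
  | .func (l := n) (.inr f) ts => Clo.comp (η.toFun n (Clo.mk (dummy f)))
      (Fin.snoc (fun i => joinMap ξ η (ts i)) (Clo.proj 0) : Fin (n + 1) → X.Clo (m + 1))

theorem eval_joinMap (ξ : CloneHom V X) (η : CloneHom W X) {B : Type u} [X.L.Structure B]
    (hB : X.Mem B) (b : B) {m : ℕ} (t : (V.L.sum W.L).Term (Fin (m + 1))) (v : Fin (m + 1) → B) :
    letI := pullback ξ B b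
    letI := pullback η B b
    (joinMap ξ η t).eval v = t.realize v := by
  let := pullback ξ B b
  let := pullback η B b
  induction t with
  | var i => exact Clo.eval_proj hB _ _
  | func f ts ih =>
    rcases f with f | f
    · refine (Clo.eval_comp hB _ _ _).trans ?_
      change _ = (ξ.toFun _ (Clo.mk (dummy f))).eval (Fin.snoc _ b : Fin _ → B)
      rw [eval_snoc_eq ξ f hB _ b (v 0)]
      congr 1
      funext i
      refine Fin.lastCases ?_ (fun j => ?_) i
      · simp [Clo.eval_proj hB]
      · simpa using ih j
    · refine (Clo.eval_comp hB _ _ _).trans ?_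
      change _ = (η.toFun _ (Clo.mk (dummy f))).eval (Fin.snoc _ b : Fin _ → B)
      rw [eval_snoc_eq η f hB _ b (v 0)]
      congr 1
      funext i
      refine Fin.lastCases ?_ (fun j => ?_) i
      · simp [Clo.eval_proj hB]
      · simpa using ih j

theorem mem_join (A : Type u) [V.L.Structure A] [W.L.Structure A] (h : V.Mem A) (k : W.Mem A) :
    letI : (join V W).L.Structure A := inferInstanceAs ((V.L.sum W.L).Structure A)
    (join V W).Mem A := by
  let : (join V W).L.Structure A := inferInstanceAs ((V.L.sum W.L).Structure A)
  refine ⟨h.1, ?_⟩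
  rintro _ (⟨e, he, rfl⟩ | ⟨e, he, rfl⟩) v
  · exact (LHom.realize_onTerm (LHom.sumInl : V.L →ᴸ V.L.sum W.L) e.1 v).trans
      ((h.2 e he v).trans (LHom.realize_onTerm (LHom.sumInl : V.L →ᴸ V.L.sum W.L) e.2 v).symm)
  · exact (LHom.realize_onTerm (LHom.sumInr : W.L →ᴸ V.L.sum W.L) e.1 v).trans
      ((k.2 e he v).trans (LHom.realize_onTerm (LHom.sumInr : W.L →ᴸ V.L.sum W.L) e.2 v).symm)

/-- Clone homomorphisms from `V` and `W` to `X` extend to the join. -/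
noncomputable def joinHom (ξ : CloneHom V X) (η : CloneHom W X) : CloneHom (join V W) X where
  toFun n := Quotient.lift (s := (join V W).termSetoid (n + 1)) (joinMap ξ η) (by
    intro s t h
    refine Clo.ext_eval fun B _ hB v => ?_
    refine (eval_joinMap ξ η hB (v 0) s v).trans
      (Eq.trans ?_ (eval_joinMap ξ η hB (v 0) t v).symm)
    let := pullback ξ B (v 0)
    let := pullback η B (v 0)
    let : (join V W).L.Structure B := inferInstanceAs ((V.L.sum W.L).Structure B)
    exact h B (mem_join B (mem_pullback ξ hB _) (mem_pullback η hB _)) v)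
  map_proj n i := rfl
  map_comp n m f g := by
    obtain ⟨t, rfl⟩ := Quotient.exists_rep f
    obtain ⟨s, rfl⟩ : ∃ s : Fin (n + 1) → (join V W).L.Term (Fin (m + 1)),
        g = fun i => Clo.mk (s i) :=
      ⟨fun i => Quotient.out (g i), funext fun i => (Quotient.out_eq (g i)).symm⟩
    change Quotient.lift _ _ (Clo.comp (Clo.mk t) _) = Clo.comp (joinMap ξ η t)
      (fun i => joinMap ξ η (s i))
    rw [Clo.comp_mk]
    change joinMap ξ η (t.subst s) = _
    refine Clo.ext_eval fun B _ hB v => ?_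
    refine (eval_joinMap ξ η hB (v 0) _ v).trans (Eq.trans ?_ (Eq.trans
      (eval_joinMap ξ η hB (v 0) t _).symm (Clo.eval_comp hB _ _ _).symm))
    let := pullback ξ B (v 0)
    let := pullback η B (v 0)
    refine (Term.realize_subst (L := V.L.sum W.L)).trans ?_
    congr 1
    funext i
    exact (eval_joinMap ξ η hB (v 0) _ _).symm

/-- The standard representative is indeed a join; in particular, joins exist. -/
theorem isJoin_join : IsJoin V W (join V W) :=
  ⟨interpretable_of_lhom (X := join V W) LHom.sumInl fun e he => Or.inl ⟨e, he, rfl⟩,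
    interpretable_of_lhom (X := join V W) LHom.sumInr fun e he => Or.inr ⟨e, he, rfl⟩,
    fun _ ⟨ξ⟩ ⟨η⟩ => ⟨joinHom ξ η⟩⟩

end Variety

/-! For each of the two properties there is a finite set of binary relations on a fixed finite set
`C` such that a variety fails the property if it has a member on `C` whose operations preserve these
relations. For varieties defined by identities of height at most one the converse holds as well, and
members of `V` and of `W` on the same set, preserving the same relations, are together a member of
`V ∨ W`.

To produce the member on `C`, take an algebra `F` of the variety that is freely generated by `C`
with respect to the algebras that witness the failure, and colour `F` by a map to `C` that fixes the
generators. Setting `f(x₁, …, xₙ)` to be the colour of `f^F(x₁, …, xₙ)` preserves identities of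
height at most one, though not identities of larger height. -/

open Relation (Comp)

/-- The basic operations of the `L`-structure on `A` preserve the binary relation `R`. -/
def IsCompatible (L : FirstOrder.Language.{u, 0}) {A : Type u} [L.Structure A]
    (R : A → A → Prop) : Prop :=
  ∀ ⦃n : ℕ⦄ (f : L.Functions n) ⦃x y : Fin n → A⦄,
    (∀ i, R (x i) (y i)) → R (Structure.funMap f x) (Structure.funMap f y)

namespace IsCompatible

variable {L : FirstOrder.Language.{u, 0}} {A : Type u} [L.Structure A]

/-- A compatible equivalence relation, bundled as a congruence. -/
def congruence {r : Setoid A} (hr : IsCompatible L r) : Congruence L A where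
  toSetoid := r
  compatible f _ _ h := hr f h

theorem realize {R : A → A → Prop} (hR : IsCompatible L R) {α : Type} (t : L.Term α)
    {v w : α → A} (hvw : ∀ i, R (v i) (w i)) : R (t.realize v) (t.realize w) := by
  induction t with
  | var i => exact hvw i
  | func f ts ih => exact hR f ih

theorem comp {R S : A → A → Prop} (hR : IsCompatible L R) (hS : IsCompatible L S) :
    IsCompatible L (Comp R S) := by
  intro n f x y h
  choose z hxz hzy using h
  exact ⟨Structure.funMap f z, hR f hxz, hS f hzy⟩

theorem exists_of_monotone {R : ℕ → A → A → Prop} (hR : ∀ k, IsCompatible L (R k))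
    (hmono : Monotone R) : IsCompatible L fun x y => ∃ k, R k x y := by
  intro n f x y h
  choose k hk using h
  exact ⟨Finset.univ.sup k,
    hR _ f fun i => hmono (Finset.le_sup (Finset.mem_univ i)) _ _ (hk i)⟩

end IsCompatible

theorem Congruence.isCompatible {L : FirstOrder.Language.{u, 0}} {A : Type u} [L.Structure A]
    (θ : Congruence L A) : IsCompatible L θ.toSetoid :=
  fun _ f x y => θ.compatible f x y

theorem Congruence.inf_apply {L : FirstOrder.Language.{u, 0}} {A : Type u} [L.Structure A]
    {θ ψ : Congruence L A} {x y : A} :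
    (θ ⊓ ψ).toSetoid x y ↔ θ.toSetoid x y ∧ ψ.toSetoid x y := by
  refine ⟨fun h => ⟨inf_le_left (a := θ) h, inf_le_right (a := θ) h⟩, fun h => ?_⟩
  rw [← sInf_pair]
  rintro φ (rfl | rfl)
  exacts [h.1, h.2]

/-- The product of a family of structures. -/
instance piStructure {L : FirstOrder.Language.{u, 0}} {I : Type*} {A : I → Type*}
    [∀ i, L.Structure (A i)] : L.Structure (∀ i, A i) where
  funMap f x i := Structure.funMap f fun j => x j i
  RelMap r x := ∀ i, Structure.RelMap r fun j => x j i

/-- The `i`-th projection of a product of structures. -/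
def projHom {L : FirstOrder.Language.{u, 0}} {I : Type*} {A : I → Type*}
    [∀ i, L.Structure (A i)] (i : I) : (∀ i, A i) →[L] A i where
  toFun p := p i
  map_fun' _ _ := rfl
  map_rel' _ _ h := h i

/-- The reflection of an algebra `F` along maps `g : C → F` and `c : F → C`. -/
@[reducible]
def reflection (L : FirstOrder.Language.{u, 0}) {F C : Type u} [L.Structure F] (g : C → F)
    (c : F → C) : L.Structure C where
  funMap f x := c (Structure.funMap f fun i => g (x i))
  RelMap r x := Structure.RelMap r fun i => g (x i)

section Height

variable {L : FirstOrder.Language.{u, 0}} {α : Type}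

theorem exists_eq_var_of_termHeight_eq_zero {t : L.Term α} (ht : termHeight t = 0) :
    ∃ i, t = .var i := by
  cases t with
  | var i => exact ⟨i, rfl⟩
  | func f ts => simp [termHeight] at ht

theorem exists_eq_var_of_termHeight_func_le_one {n : ℕ} {f : L.Functions n}
    {ts : Fin n → L.Term α} (h : termHeight (.func f ts) ≤ 1) : ∃ x : Fin n → α, ts = .var ∘ x := by
  have hts : ∀ i, termHeight (ts i) = 0 := fun i => by
    have := Finset.le_sup (f := fun i => termHeight (ts i)) (Finset.mem_univ i)
    simp only [termHeight] at h this
    omega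
  choose x hx using fun i => exists_eq_var_of_termHeight_eq_zero (hts i)
  exact ⟨x, funext hx⟩

theorem realize_reflection {F C : Type u} [L.Structure F] {g : C → F} {c : F → C}
    (hc : Function.LeftInverse c g) {t : L.Term α} (ht : termHeight t ≤ 1) (v : α → C) :
    letI := reflection L g c
    t.realize v = c (t.realize fun i => g (v i)) := by
  let := reflection L g c
  cases t with
  | var i => exact (hc _).symm
  | func f ts =>
    obtain ⟨x, rfl⟩ := exists_eq_var_of_termHeight_func_le_one ht
    rfl

end Height

namespace Variety

theorem Mem.of_separating_homs {V : Variety.{u}} {A : Type u} [V.L.Structure A] [Nonempty A]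
    {I : Sort*} {B : I → Type u} [∀ i, V.L.Structure (B i)] (hB : ∀ i, V.Mem (B i))
    (φ : ∀ i, A →[V.L] B i) (hφ : ∀ x y, (∀ i, φ i x = φ i y) → x = y) : V.Mem A := by
  refine ⟨inferInstance, fun e he v => hφ _ _ fun i => ?_⟩
  rw [← HomClass.realize_term, ← HomClass.realize_term]
  exact (hB i).2 e he _

theorem Mem.pi {V : Variety.{u}} {I : Type u} {A : I → Type u} [∀ i, V.L.Structure (A i)]
    (hA : ∀ i, V.Mem (A i)) : V.Mem (∀ i, A i) :=
  have := fun i => (hA i).1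
  .of_separating_homs hA projHom fun _ _ => funext

theorem Mem.reflection {V : Variety.{u}} (hV : V.DefinedByHeightAtMostOne) {F C : Type u}
    [V.L.Structure F] (hF : V.Mem F) {g : C → F} {c : F → C} (hc : Function.LeftInverse c g) :
    letI := reflection V.L g c
    V.Mem C := by
  let := _root_.reflection V.L g c
  obtain ⟨E, hE, hVE⟩ := hV
  rw [hVE] at hF ⊢
  refine ⟨hF.1.map c, fun e he v => ?_⟩
  rw [realize_reflection hc (hE e he).1, realize_reflection hc (hE e he).2, hF.2 e he]

/-- `V` has a member on the set `C` whose operations preserve all relations in `𝓡`. In other words,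
`V` has an interpretation in the polymorphism clone of the relational structure `(C; 𝓡)`. -/
def HasCompatibleMember (V : Variety.{u}) {C : Type u} (𝓡 : Set (C → C → Prop)) : Prop :=
  ∃ _ : V.L.Structure C, V.Mem C ∧ ∀ R ∈ 𝓡, IsCompatible V.L R

theorem isCompatible_pullback {V X : Variety.{u}} (ξ : CloneHom V X) {B : Type u}
    [X.L.Structure B] {b : B} {R : B → B → Prop} (hb : R b b) (hR : IsCompatible X.L R) :
    letI := pullback ξ B b
    IsCompatible V.L R := by
  intro n f x y hxy
  refine hR.realize _ fun i => ?_
  refine Fin.lastCases ?_ (fun j => ?_) i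
  · simpa only [Fin.snoc_last] using hb
  · simpa only [Fin.snoc_castSucc] using hxy j

theorem HasCompatibleMember.of_interpretable {V X : Variety.{u}} (hVX : Interpretable V X)
    {C : Type u} {𝓡 : Set (C → C → Prop)} (hrefl : ∀ R ∈ 𝓡, ∀ x, R x x)
    (hX : X.HasCompatibleMember 𝓡) : V.HasCompatibleMember 𝓡 := by
  obtain ⟨ξ⟩ := hVX
  obtain ⟨_, hC, h𝓡⟩ := hX
  obtain ⟨b⟩ := hC.1
  exact ⟨pullback ξ C b, mem_pullback ξ hC b,
    fun R hR => isCompatible_pullback ξ (hrefl R hR b) (h𝓡 R hR)⟩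

theorem HasCompatibleMember.join {V W : Variety.{u}} {C : Type u} {𝓡 : Set (C → C → Prop)}
    (hV : V.HasCompatibleMember 𝓡) (hW : W.HasCompatibleMember 𝓡) :
    (join V W).HasCompatibleMember 𝓡 := by
  obtain ⟨_, hVC, hV𝓡⟩ := hV
  obtain ⟨_, hWC, hW𝓡⟩ := hW
  refine ⟨inferInstanceAs ((V.L.sum W.L).Structure C), mem_join C hVC hWC, fun R hR => ?_⟩
  rintro n (f | f) x y hxy
  · exact hV𝓡 R hR f hxy
  · exact hW𝓡 R hR f hxy

end Variety

/-! ### Congruence modularity -/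

namespace Congruence

variable {L : FirstOrder.Language.{u, 0}} {A : Type u} [L.Structure A] (β γ : Congruence L A)

/-- The relations `β`, `β ∘ γ ∘ β`, `(β ∘ γ ∘ β) ∘ γ ∘ (β ∘ γ ∘ β)`, …, whose union is `β ⊔ γ`. The
nested form makes each of them symmetric and lets one step of modularity pass to the next. -/
def nestedComp : ℕ → A → A → Prop
  | 0 => β.toSetoid
  | k + 1 => Comp (nestedComp k) (Comp γ.toSetoid (nestedComp k))

theorem nestedComp_refl (k : ℕ) (x : A) : nestedComp β γ k x x := by
  induction k with
  | zero => exact β.toSetoid.refl x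
  | succ k ih => exact ⟨x, ih, x, γ.toSetoid.refl x, ih⟩

theorem nestedComp_symm (k : ℕ) {x y : A} (h : nestedComp β γ k x y) : nestedComp β γ k y x := by
  induction k generalizing x y with
  | zero => exact β.toSetoid.symm h
  | succ k ih =>
    obtain ⟨a, hxa, b, hab, hby⟩ := h
    exact ⟨b, ih hby, a, γ.toSetoid.symm hab, ih hxa⟩

theorem monotone_nestedComp : Monotone (nestedComp β γ) :=
  monotone_nat_of_le_succ fun k _ y h =>
    ⟨y, h, y, γ.toSetoid.refl y, nestedComp_refl β γ k y⟩

theorem isCompatible_nestedComp (k : ℕ) : IsCompatible L (nestedComp β γ k) := by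
  induction k with
  | zero => exact β.isCompatible
  | succ k ih => exact ih.comp (γ.isCompatible.comp ih)

theorem exists_nestedComp_of_sup {x y : A} (h : (β ⊔ γ).toSetoid x y) :
    ∃ k, nestedComp β γ k x y := by
  let r : Setoid A :=
    { r := fun x y => ∃ k, nestedComp β γ k x y
      iseqv :=
        { refl := fun x => ⟨0, nestedComp_refl β γ 0 x⟩
          symm := fun ⟨k, h⟩ => ⟨k, nestedComp_symm β γ k h⟩
          trans := fun {_ y _} ⟨k, h⟩ ⟨l, h'⟩ =>
            ⟨max k l + 1, y, monotone_nestedComp β γ (le_max_left k l) _ _ h, y,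
              γ.toSetoid.refl y, monotone_nestedComp β γ (le_max_right k l) _ _ h'⟩ } }
  have hr : IsCompatible L r :=
    .exists_of_monotone (isCompatible_nestedComp β γ) (monotone_nestedComp β γ)
  have hβ : β ≤ hr.congruence := fun _ _ h => ⟨0, h⟩
  have hγ : γ ≤ hr.congruence := fun x y h => ⟨1, x, β.toSetoid.refl x, y, h, β.toSetoid.refl y⟩
  exact sup_le hβ hγ h

end Congruence

/-- A failure of Gumm's shifting principle: congruences `γ ≤ α` and a reflexive compatible relation
`R` with `α ∩ R ⊆ γ`, and a quadrangle with sides `a γ b`, `a R c`, `b R d` and `c α d` such that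
`c` and `d` are not related by `γ`. -/
structure ShiftingFailure (L : FirstOrder.Language.{u, 0}) (A : Type u) [L.Structure A] where
  (α γ : Congruence L A)
  (R : A → A → Prop)
  (a b c d : A)
  le : γ ≤ α
  refl : ∀ x, R x x
  isCompatible : IsCompatible L R
  γ_of_α_of_R : ∀ {x y}, α.toSetoid x y → R x y → γ.toSetoid x y
  γ_ab : γ.toSetoid a b
  R_ac : R a c
  R_bd : R b d
  α_cd : α.toSetoid c d
  not_γ_cd : ¬ γ.toSetoid c d

/-- The four-element set `{0, 1}²`. -/
abbrev Square : Type u := ULift.{u} (Bool × Bool)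

namespace Square

/-- Equality of first coordinates. -/
def eqFst : Setoid Square.{u} := .ker fun s => s.down.1

/-- Equality of second coordinates. -/
def eqSnd : Setoid Square.{u} := .ker fun s => s.down.2

/-- The equivalence relation whose only nontrivial class is `{(0, 0), (0, 1)}`. -/
def eqLower : Setoid Square.{u} := .ker fun s => (s.down.1, s.down.1 && s.down.2)

/-- The equivalences `eqFst`, `eqSnd` and `eqLower`, which generate a pentagon in the lattice of
equivalence relations on the square. -/
def pentagon : Set (Square.{u} → Square.{u} → Prop) := {⇑eqFst, ⇑eqSnd, ⇑eqLower}

theorem eqLower_iff {s t : Square.{u}} :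
    eqLower s t ↔ s.down.1 = t.down.1 ∧ (s.down.1 = true → s.down.2 = t.down.2) := by
  change (s.down.1, s.down.1 && s.down.2) = (t.down.1, t.down.1 && t.down.2) ↔ _
  rcases s with ⟨_ | _, _⟩ <;> rcases t with ⟨_ | _, _⟩ <;> simp

end Square

open Square

section Shifting

variable {L : FirstOrder.Language.{u, 0}} {A : Type u} [L.Structure A]

theorem Congruence.of_nestedComp_of_isEmpty_shiftingFailure [IsEmpty (ShiftingFailure L A)]
    {α β δ : Congruence L A} (hδα : δ ≤ α) (hβα : β ⊓ α ≤ δ) (k : ℕ) {x y : A}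
    (hα : α.toSetoid x y) (h : nestedComp β δ k x y) : δ.toSetoid x y := by
  induction k generalizing x y with
  | zero => exact hβα (inf_apply.2 ⟨h, hα⟩)
  | succ k ih =>
    obtain ⟨a, hxa, b, hab, hby⟩ := h
    by_contra hxy
    exact isEmptyElim
      { α, γ := δ, R := nestedComp β δ k, a, b, c := x, d := y
        le := hδα
        refl := nestedComp_refl β δ k
        isCompatible := isCompatible_nestedComp β δ k
        γ_of_α_of_R := ih
        γ_ab := hab
        R_ac := nestedComp_symm β δ k hxa
        R_bd := hby
        α_cd := hα
        not_γ_cd := hxy : ShiftingFailure L A }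

theorem isModularLattice_of_isEmpty_shiftingFailure [IsEmpty (ShiftingFailure L A)] :
    IsModularLattice (Congruence L A) where
  sup_inf_le_assoc_of_le {γ} β α hγα := by
    intro x y hxy
    obtain ⟨hsup, hα⟩ := Congruence.inf_apply.1 hxy
    have hle : γ ⊔ β ≤ β ⊔ (γ ⊔ β ⊓ α) := sup_le (le_sup_left.trans le_sup_right) le_sup_left
    obtain ⟨k, hk⟩ := Congruence.exists_nestedComp_of_sup _ _ (hle hsup)
    exact Congruence.of_nestedComp_of_isEmpty_shiftingFailure (sup_le hγα inf_le_right)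
      le_sup_right k hα hk

end Shifting

namespace ShiftingFailure

/-- The element `y` on generators with first coordinate `1`, and `x` on the others. -/
def fstEval {A : Type u} (x y : A) (s : Square.{u}) : A := bif s.down.1 then y else x

variable {L : FirstOrder.Language.{u, 0}} {A : Type u} [L.Structure A] (T : ShiftingFailure L A)

/-- The element `d` on generators with second coordinate `1`, and `c` on the others. -/
def sndEval (s : Square.{u}) : A := bif s.down.2 then T.d else T.c

/-- The map from the square onto the vertices `a`, `b`, `c`, `d` of the quadrangle. -/
def cornerEval (s : Square.{u}) : A :=
  bif s.down.1 then T.sndEval s else bif s.down.2 then T.b else T.a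

open Classical in
/-- The colouring of the algebra `A ^ (A ^ Square)`, in which the projections to the coordinates
`w : Square → A` are the evaluations of the generators. The first coordinate of a colour tells
whether collapsing the generators along `fst` turns an element into the generator `1`. -/
noncomputable def color (p : (Square.{u} → A) → A) : Square.{u} :=
  ⟨decide (∀ x y, p (fstEval x y) = y), decide (T.γ.toSetoid (p T.sndEval) T.d)⟩

theorem leftInverse_color : Function.LeftInverse T.color fun s w => w s := by
  have hcd : T.c ≠ T.d := fun h => T.not_γ_cd (h ▸ T.γ.toSetoid.refl T.c)
  have hfst : ∀ s : Square.{u}, (∀ x y : A, fstEval x y s = y) ↔ s.down.1 = true := by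
    rintro ⟨_ | _, _⟩
    · simpa [fstEval] using ⟨_, _, hcd⟩
    · simp [fstEval]
  have hsnd : ∀ s : Square.{u}, T.γ.toSetoid (T.sndEval s) T.d ↔ s.down.2 = true := by
    rintro ⟨_, _ | _⟩
    · simpa [sndEval] using T.not_γ_cd
    · simp [sndEval]
  intro s
  simp only [color, hfst, hsnd, Bool.decide_eq_true]

theorem fstEval_congr {s t : Square.{u}} (h : eqFst s t) (x y : A) :
    fstEval x y s = fstEval x y t :=
  congrArg (bif · then y else x) h

theorem sndEval_congr {s t : Square.{u}} (h : eqSnd s t) : T.sndEval s = T.sndEval t :=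
  congrArg (bif · then T.d else T.c) h

theorem R_cornerEval_sndEval (s : Square.{u}) : T.R (T.cornerEval s) (T.sndEval s) := by
  rcases s with ⟨_ | _, _ | _⟩
  exacts [T.R_ac, T.R_bd, T.refl _, T.refl _]

theorem α_cornerEval_fstEval (s : Square.{u}) :
    T.α.toSetoid (T.cornerEval s) (fstEval T.a T.c s) := by
  rcases s with ⟨_ | _, _ | _⟩
  exacts [T.α.toSetoid.refl _, T.α.toSetoid.symm (T.le T.γ_ab), T.α.toSetoid.refl _,
    T.α.toSetoid.symm T.α_cd]

theorem α_sndEval_fstEval (s : Square.{u}) : T.α.toSetoid (T.sndEval s) (fstEval T.c T.c s) := by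
  rcases s with ⟨_ | _, _ | _⟩
  exacts [T.α.toSetoid.refl _, T.α.toSetoid.symm T.α_cd, T.α.toSetoid.refl _,
    T.α.toSetoid.symm T.α_cd]

theorem γ_cornerEval {s t : Square.{u}} (h : eqLower s t) :
    T.γ.toSetoid (T.cornerEval s) (T.cornerEval t) := by
  obtain ⟨hfst, hsnd⟩ := eqLower_iff.1 h
  rcases s with ⟨_ | _, _ | _⟩ <;> rcases t with ⟨_ | _, _ | _⟩ <;> cases hfst
  case false.false.false.true => exact T.γ_ab
  case false.true.false.false => exact T.γ.toSetoid.symm T.γ_ab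
  case true.false.true.true => cases hsnd rfl
  case true.true.true.false => cases hsnd rfl
  all_goals exact T.γ.toSetoid.refl _

theorem γ_funMap_cornerEval_sndEval {n : ℕ} {f : L.Functions n} {z : Fin n → Square.{u}}
    (hz : ∀ x y : A, Structure.funMap f (fun i => fstEval x y (z i)) = y) :
    T.γ.toSetoid (Structure.funMap f fun i => T.cornerEval (z i))
      (Structure.funMap f fun i => T.sndEval (z i)) := by
  have hcorner := T.α.compatible f _ _ fun i => T.α_cornerEval_fstEval (z i)
  have hsnd := T.α.compatible f _ _ fun i => T.α_sndEval_fstEval (z i)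
  rw [hz] at hcorner hsnd
  exact T.γ_of_α_of_R (T.α.toSetoid.trans hcorner (T.α.toSetoid.symm hsnd))
    (T.isCompatible f fun i => T.R_cornerEval_sndEval (z i))

/-- The structure on the square given by the colours of the values in `A ^ (A ^ Square)`. -/
@[reducible]
noncomputable def squareStructure : L.Structure Square.{u} :=
  reflection L (fun s (w : Square.{u} → A) => w s) T.color

theorem isCompatible_eqFst :
    letI := T.squareStructure
    IsCompatible L eqFst.{u} := by
  classical
  intro n f x y h
  have hxy : ∀ u v : A, (fun i => fstEval u v (x i)) = fun i => fstEval u v (y i) :=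
    fun u v => funext fun i => fstEval_congr (h i) u v
  change decide (∀ u v, Structure.funMap f (fun i => fstEval u v (x i)) = v) =
    decide (∀ u v, Structure.funMap f (fun i => fstEval u v (y i)) = v)
  simp only [hxy]

theorem isCompatible_eqSnd :
    letI := T.squareStructure
    IsCompatible L eqSnd.{u} := by
  classical
  intro n f x y h
  have hxy : (fun i => T.sndEval (x i)) = fun i => T.sndEval (y i) :=
    funext fun i => T.sndEval_congr (h i)
  change decide (T.γ.toSetoid (Structure.funMap f fun i => T.sndEval (x i)) T.d) =
    decide (T.γ.toSetoid (Structure.funMap f fun i => T.sndEval (y i)) T.d)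
  rw [hxy]

theorem isCompatible_eqLower :
    letI := T.squareStructure
    IsCompatible L eqLower.{u} := by
  classical
  let := T.squareStructure
  intro n f x y h
  have hfst : (Structure.funMap f x).down.1 = (Structure.funMap f y).down.1 :=
    T.isCompatible_eqFst f fun i => (eqLower_iff.1 (h i)).1
  refine eqLower_iff.2 ⟨hfst, fun htrue => ?_⟩
  have hcorner := T.γ.compatible f _ _ fun i => T.γ_cornerEval (h i)
  have hx := T.γ_funMap_cornerEval_sndEval (of_decide_eq_true htrue)
  have hy := T.γ_funMap_cornerEval_sndEval (of_decide_eq_true (hfst.symm.trans htrue))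
  have hxy := T.γ.toSetoid.trans (T.γ.toSetoid.symm hx) (T.γ.toSetoid.trans hcorner hy)
  exact decide_eq_decide.2
    ⟨T.γ.toSetoid.trans (T.γ.toSetoid.symm hxy), T.γ.toSetoid.trans hxy⟩

end ShiftingFailure

namespace Variety

theorem not_congruenceModular_of_pentagon {V : Variety.{u}}
    (hV : V.HasCompatibleMember pentagon.{u}) : ¬ V.CongruenceModular := by
  obtain ⟨_, hmem, hcomp⟩ := hV
  intro hmod
  have := hmod Square hmem
  let α := (hcomp eqFst (by simp [pentagon])).congruence
  let β := (hcomp eqSnd (by simp [pentagon])).congruence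
  let γ := (hcomp eqLower (by simp [pentagon])).congruence
  have hγα : γ ≤ α := fun _ _ h => (eqLower_iff.1 h).1
  have hβα : β ⊓ α ≤ γ := fun _ _ h =>
    have ⟨hβ, hα⟩ := Congruence.inf_apply.1 h
    eqLower_iff.2 ⟨hα, fun _ => hβ⟩
  have hle : (γ ⊔ β) ⊓ α ≤ γ :=
    (IsModularLattice.sup_inf_le_assoc_of_le β hγα).trans (sup_le le_rfl hβα)
  have hβ : ∀ i j k : Bool, (γ ⊔ β).toSetoid ⟨(i, k)⟩ ⟨(j, k)⟩ := fun _ _ _ =>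
    (le_sup_right : β ≤ γ ⊔ β) rfl
  have hγ : (γ ⊔ β).toSetoid ⟨(false, false)⟩ ⟨(false, true)⟩ := (le_sup_left : γ ≤ γ ⊔ β) rfl
  have hsup : (γ ⊔ β).toSetoid ⟨(true, false)⟩ ⟨(true, true)⟩ :=
    (γ ⊔ β).toSetoid.trans (hβ _ _ _) ((γ ⊔ β).toSetoid.trans hγ (hβ _ _ _))
  have : γ.toSetoid ⟨(true, false)⟩ ⟨(true, true)⟩ := hle (Congruence.inf_apply.2 ⟨hsup, rfl⟩)
  cases (eqLower_iff.1 this).2 rfl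

theorem DefinedByHeightAtMostOne.hasCompatibleMember_pentagon {V : Variety.{u}}
    (hV : V.DefinedByHeightAtMostOne) (hmod : ¬ V.CongruenceModular) :
    V.HasCompatibleMember pentagon.{u} := by
  simp only [CongruenceModular, not_forall] at hmod
  obtain ⟨A, _, hA, hmod⟩ := hmod
  have ⟨T⟩ : Nonempty (ShiftingFailure V.L A) := by
    by_contra! _
    exact hmod isModularLattice_of_isEmpty_shiftingFailure
  refine ⟨T.squareStructure, .reflection hV (.pi fun _ => hA) T.leftInverse_color, ?_⟩
  rintro R (rfl | rfl | rfl)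
  exacts [T.isCompatible_eqFst, T.isCompatible_eqSnd, T.isCompatible_eqLower]

end Variety

/-! ### Congruence permutability -/

namespace Congruence

variable {L : FirstOrder.Language.{u, 0}}

theorem altComp_succ {A : Type u} [L.Structure A] {n : ℕ} {θ ψ : Congruence L A} {a b : A}
    (h : altComp n θ ψ a b) : altComp (n + 1) θ ψ a b := by
  induction n generalizing θ ψ a with
  | zero => exact ⟨b, h ▸ θ.toSetoid.refl a, rfl⟩
  | succ n ih =>
    obtain ⟨c, hac, hcb⟩ := h
    exact ⟨c, hac, ih hcb⟩

end Congruence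

section Sequences

variable {L : FirstOrder.Language.{u, 0}} {B : Type u} [L.Structure B]

/-- The congruence on an algebra of sequences that identifies sequences which agree at all places
of the same parity as `j`. -/
def Congruence.eqOnParity (S : L.Substructure (ℕ → B)) (j : ℕ) : Congruence L S where
  toSetoid :=
    { r := fun x y => ∀ k, k ≡ j [MOD 2] → x.1 k = y.1 k
      iseqv := ⟨fun _ _ _ => rfl, fun h k hk => (h k hk).symm,
        fun h h' k hk => (h k hk).trans (h' k hk)⟩ }
  compatible f _ _ h k hk := congrArg (Structure.funMap f) (funext fun i => h i k hk)

theorem Congruence.eqOnParity_apply {S : L.Substructure (ℕ → B)} {j : ℕ} {x y : S} :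
    (eqOnParity S j).toSetoid x y ↔ ∀ k, k ≡ j [MOD 2] → x.1 k = y.1 k :=
  .rfl

theorem Congruence.eqOnParity_add_two (S : L.Substructure (ℕ → B)) (j : ℕ) :
    eqOnParity S (j + 2) = eqOnParity S j := by
  simp only [eqOnParity, Nat.ModEq, Nat.add_mod_right]

variable [Preorder B]

/-- The subalgebra of the antitone sequences in the power `B ^ ℕ` of an ordered algebra `B`. -/
def antitoneSequences (hB : IsCompatible L ((· ≤ ·) : B → B → Prop)) : L.Substructure (ℕ → B) where
  carrier := {s | Antitone s}
  fun_mem f _ hx _ _ hkl := hB f fun i => hx i hkl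

variable {hB : IsCompatible L ((· ≤ ·) : B → B → Prop)} {a b : B}

/-- The antitone sequence that takes the value `b` at the first `m` places and `a` afterwards. -/
def stepSequence (hB : IsCompatible L ((· ≤ ·) : B → B → Prop)) (hab : a ≤ b) (m : ℕ) :
    antitoneSequences hB :=
  ⟨fun k => if k < m then b else a, fun k l hkl => by
    dsimp only
    split_ifs with hl hk
    exacts [le_rfl, absurd (hkl.trans_lt hl) hk, hab, le_rfl]⟩

theorem altComp_stepSequence (hab : a ≤ b) (j m : ℕ) :
    Congruence.altComp m (.eqOnParity _ (j + 1)) (.eqOnParity _ j)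
      (stepSequence hB hab j) (stepSequence hB hab (j + m)) := by
  induction m generalizing j with
  | zero => rfl
  | succ m ih =>
    refine ⟨stepSequence hB hab (j + 1), Congruence.eqOnParity_apply.2 fun k hk => ?_, ?_⟩
    · have : k < j ↔ k < j + 1 := by grind [Nat.ModEq]
      simp only [stepSequence, this]
    · simpa only [Congruence.eqOnParity_add_two, Nat.add_right_comm, Nat.add_assoc] using ih (j + 1)

theorem apply_le_of_altComp_eqOnParity {j n : ℕ} {x y : antitoneSequences hB}
    (hxy : Congruence.altComp (n + 1) (.eqOnParity _ j) (.eqOnParity _ (j + 1)) x y)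
    (hx : x.1 j ≤ a) : y.1 (j + n) ≤ a := by
  induction n generalizing j x with
  | zero =>
    obtain ⟨_, hxz, rfl⟩ := hxy
    exact (Congruence.eqOnParity_apply.1 hxz j rfl).ge.trans hx
  | succ n ih =>
    obtain ⟨z, hxz, hzy⟩ := hxy
    rw [← Congruence.eqOnParity_add_two _ j] at hzy
    have hzj : z.1 j ≤ a := (Congruence.eqOnParity_apply.1 hxz j rfl).ge.trans hx
    have hz : z.1 (j + 1) ≤ a := (z.2 j.le_succ).trans hzj
    simpa only [Nat.add_right_comm, Nat.add_assoc] using ih hzy hz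

end Sequences

theorem Variety.not_congruencePermutable_of_lt {V : Variety.{u}} {B : Type u} [V.L.Structure B]
    [Preorder B] (hV : V.Mem B) (hB : IsCompatible V.L ((· ≤ ·) : B → B → Prop)) {a b : B}
    (hab : a < b) {n : ℕ} (hn : n ≠ 0) : ¬ V.CongruencePermutable n := by
  intro hperm
  obtain ⟨m, rfl⟩ := Nat.exists_eq_succ_of_ne_zero hn
  have : Nonempty (antitoneSequences hB) := ⟨stepSequence hB hab.le 0⟩
  have hS : V.Mem (antitoneSequences hB) :=
    .of_separating_homs (fun _ : ℕ => hV)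
      (fun k => (projHom k).comp (antitoneSequences hB).subtype.toHom)
      fun _ _ h => Subtype.ext (funext h)
  have hpath := altComp_stepSequence (hB := hB) hab.le 0 (m + 1)
  rw [hperm _ hS] at hpath
  have := apply_le_of_altComp_eqOnParity hpath (a := a) (by simp [stepSequence])
  simp [stepSequence, hab.not_ge] at this

/-- `ReachedIn L gen k p` says that `p` is obtained from the generator `gen 1` in `k` steps, each of
which replaces some `f(gen x₁, …, gen xₙ)` by `f(gen y₁, …, gen yₙ)` with `xᵢ ≤ yᵢ`. If `gen 0` is
reached, then the symbols `f`, with variables identified according to the pairs `(xᵢ, yᵢ)`, give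
Hagemann–Mitschke terms. -/
inductive ReachedIn (L : FirstOrder.Language.{u, 0}) {F : Type u} [L.Structure F]
    (gen : ULift.{u} Bool → F) : ℕ → F → Prop
  | generator : ReachedIn L gen 0 (gen ⟨true⟩)
  | step {k n : ℕ} (f : L.Functions n) {x y : Fin n → ULift.{u} Bool} (hxy : ∀ i, x i ≤ y i) :
    ReachedIn L gen k (Structure.funMap f fun i => gen (x i)) →
      ReachedIn L gen (k + 1) (Structure.funMap f fun i => gen (y i))

section Reached

variable {L : FirstOrder.Language.{u, 0}} {F A : Type u} [L.Structure F] [L.Structure A]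
  {gen : ULift.{u} Bool → F}

theorem ReachedIn.altComp {k : ℕ} {p : F} (hp : ReachedIn L gen k p)
    (hfree : ∀ w : ULift.{u} Bool → A, ∃ φ : F →[L] A, ∀ s, φ (gen s) = w s)
    {θ ψ : Congruence L A} {φ : F →[L] A} {m : ℕ} (hkm : k ≤ m) {e : A}
    (hθ : θ.toSetoid (φ (gen ⟨false⟩)) (φ (gen ⟨true⟩)))
    (hm : Congruence.altComp m ψ θ (φ (gen ⟨true⟩)) e) :
    Congruence.altComp (m + 1) ψ θ (φ p) e := by
  induction hp generalizing θ ψ φ m with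
  | generator => exact Congruence.altComp_succ hm
  | @step k n f x y hxy _ ih =>
    obtain ⟨m, rfl⟩ := Nat.exists_eq_succ_of_ne_zero (Nat.ne_zero_of_lt hkm)
    obtain ⟨c, hψ, hc⟩ := hm
    -- One step back in the derivation of `p`, the generators move on to the next link of the chain.
    obtain ⟨φ', hφ'⟩ := hfree fun s => bif s.down then c else φ (gen ⟨true⟩)
    have hψ' : ψ.toSetoid (φ' (gen ⟨false⟩)) (φ' (gen ⟨true⟩)) := by simpa [hφ'] using hψ
    obtain ⟨d, hd, hde⟩ := ih (Nat.le_of_succ_le_succ hkm) hψ' (by simpa [hφ'] using hc)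
    refine ⟨Structure.funMap f fun i => bif (x i).down then c else φ (gen (y i)), ?_, d, ?_, hde⟩
    · rw [φ.map_fun]
      refine ψ.compatible f _ _ fun i => ?_
      cases hx : (x i).down with
      | false => exact ψ.toSetoid.refl _
      | true =>
        have hy : y i = ⟨true⟩ := ULift.ext _ _ (Bool.le_iff_imp.1 (hxy i) hx)
        simpa [hy] using hψ
    · refine θ.toSetoid.trans ?_ hd
      rw [φ'.map_fun]
      refine θ.compatible f _ _ fun i => ?_
      rw [Function.comp_apply, hφ']
      cases (x i).down with
      | false =>
        rcases y i with ⟨_ | _⟩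
        exacts [hθ, θ.toSetoid.refl _]
      | true => exact θ.toSetoid.refl _

theorem altComp_comm_of_reachedIn {k n : ℕ} (hk : ReachedIn L gen k (gen ⟨false⟩))
    (hfree : ∀ w : ULift.{u} Bool → A, ∃ φ : F →[L] A, ∀ s, φ (gen s) = w s)
    (hkn : k < n) (θ ψ : Congruence L A) :
    Congruence.altComp n θ ψ = Congruence.altComp n ψ θ := by
  have hle : ∀ (θ ψ : Congruence L A) x y,
      Congruence.altComp n θ ψ x y → Congruence.altComp n ψ θ x y := by
    obtain ⟨m, rfl⟩ := Nat.exists_eq_succ_of_ne_zero (Nat.ne_zero_of_lt hkn)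
    rintro θ ψ x y ⟨z, hxz, hzy⟩
    obtain ⟨φ, hφ⟩ := hfree fun s => bif s.down then z else x
    have := hk.altComp hfree (θ := θ) (ψ := ψ) (φ := φ) (Nat.le_of_lt_succ hkn)
      (by simpa [hφ] using hxz) (by simpa [hφ] using hzy)
    simpa [hφ] using this
  exact funext₂ fun x y => propext ⟨hle θ ψ x y, hle ψ θ x y⟩

end Reached

theorem Variety.DefinedByHeightAtMostOne.hasCompatibleMember_le {V : Variety.{u}}
    (hV : V.DefinedByHeightAtMostOne) (hperm : ∀ n, 2 ≤ n → ¬ V.CongruencePermutable n) :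
    V.HasCompatibleMember {((· ≤ ·) : ULift.{u} Bool → ULift.{u} Bool → Prop)} := by
  classical
  have hfail : ∀ k : ℕ, ∃ (A : Type u) (_ : V.L.Structure A), V.Mem A ∧
      ∃ θ ψ : Congruence V.L A,
        Congruence.altComp (k + 2) θ ψ ≠ Congruence.altComp (k + 2) ψ θ := by
    simpa [CongruencePermutable] using fun k => hperm (k + 2) (by omega)
  choose A _ hA θ ψ hne using hfail
  let gen : ULift.{u} Bool → ∀ i : Σ k, ULift.{u} Bool → A k, A i.1 := fun s i => i.2 s
  have hreach : ∀ k, ¬ ReachedIn V.L gen k (gen ⟨false⟩) := fun k hk =>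
    hne k <| altComp_comm_of_reachedIn hk (fun w => ⟨projHom (Sigma.mk k w), fun _ => rfl⟩)
      (by omega) _ _
  let color (p : ∀ i : Σ k, ULift.{u} Bool → A k, A i.1) : ULift.{u} Bool :=
    ⟨decide (∃ k, ReachedIn V.L gen k p)⟩
  have hcolor : Function.LeftInverse color gen := by
    rintro ⟨_ | _⟩
    · simpa [color] using hreach
    · simpa [color] using ⟨0, .generator⟩
  refine ⟨reflection V.L gen color, .reflection hV (.pi fun i => hA i.1) hcolor, ?_⟩
  rintro _ rfl n f x y hxy
  refine Bool.le_iff_imp.2 fun hx => ?_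
  obtain ⟨k, hk⟩ := of_decide_eq_true hx
  exact decide_eq_true ⟨k + 1, .step f hxy hk⟩

theorem theorem1p8_general {V W U : Variety.{u}} (hV : V.DefinedByHeightAtMostOne)
    (hW : W.DefinedByHeightAtMostOne) (hU : Variety.Interpretable U (Variety.join V W)) :
    (¬ V.CongruenceModular → ¬ W.CongruenceModular → ¬ U.CongruenceModular) ∧
    ((∀ n, 2 ≤ n → ¬ V.CongruencePermutable n) → (∀ n, 2 ≤ n → ¬ W.CongruencePermutable n) →
      ∀ n, 2 ≤ n → ¬ U.CongruencePermutable n) := by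
  refine ⟨fun hVmod hWmod => ?_, fun hVperm hWperm n hn => ?_⟩
  · have hjoin := (hV.hasCompatibleMember_pentagon hVmod).join
      (hW.hasCompatibleMember_pentagon hWmod)
    refine Variety.not_congruenceModular_of_pentagon (hjoin.of_interpretable hU ?_)
    rintro R (rfl | rfl | rfl)
    exacts [eqFst.refl, eqSnd.refl, eqLower.refl]
  · have hjoin := (hV.hasCompatibleMember_le hVperm).join (hW.hasCompatibleMember_le hWperm)
    obtain ⟨_, hmem, hle⟩ := hjoin.of_interpretable hU (by rintro _ rfl; exact le_refl)
    have hlt : (⟨false⟩ : ULift.{u} Bool) < ⟨true⟩ := Bool.false_lt_true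
    exact Variety.not_congruencePermutable_of_lt hmem (hle _ rfl) hlt (by omega)

theorem theorem1p8 (V W : Variety.{u})
    (hV : V.DefinedByHeightAtMostOne) (hW : W.DefinedByHeightAtMostOne)
    (U : Variety.{u}) (hU : Variety.IsJoin V W U) :
    (¬ V.CongruenceModular → ¬ W.CongruenceModular → ¬ U.CongruenceModular) ∧
    ((∀ n, 2 ≤ n → ¬ V.CongruencePermutable n) → (∀ n, 2 ≤ n → ¬ W.CongruencePermutable n) →
      ∀ n, 2 ≤ n → ¬ U.CongruencePermutable n) :=
  theorem1p8_general hV hW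
    (hU.2.2 (Variety.join V W) Variety.isJoin_join.1 Variety.isJoin_join.2.1)
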